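/- Let $\delta\ge 3$ be an integer and let $v_0,\dots,v_\delta$ be real numbers, not all zero. Consider the $\delta$-PHO (perturbed two-dimensional isotropic harmonic oscillator with a homogeneous polynomial potential of degree $\delta$), i.e. the Hamiltonian system on $\mathbb R^2\times\mathbb R^2$ with canonical coordinates $(q_1,q_2,p_1,p_2)$ and Hamiltonian $$K^{(\delta)}(q,p)=\frac12\sum_{j=1}^2(p_j^2+q_j^2)+\sum_{h=0}^{\delta}v_h\binom{\delta}{h}q_1^{h}q_2^{\delta-h}.$$ Put $$\mathcal M(K^{(\delta)})=\begin{pmatrix} v_0-v_2 & v_1-v_3&\cdots& v_{\delta-2}-v_\delta\\ 2v_1&2v_2&\cdots&2v_{\delta-1}\end{pmatrix},$$ a $2\times(\delta-1)$ matrix. A first integral quadratic in the momenta means a function $$F(q,p)=\sum_{i,j=1}^{2}a_{ij}(q)p_ip_j+\sum_{i=1}^{2}b_i(q)p_i+c(q)$$ with coefficients $a_{ij},b_i,c\in C^\infty(\mathbb R^2)$ and quadratic part $\sum_{i,j} a_{ij}(q)p_ip_j$ not identically zero, such that $F$ Poisson-commutes with $K^{(\delta)}$ and is functionally independent of it ($dF$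 and $dK^{(\delta)}$ are linearly independent at some point of $\mathbb R^2\times\mathbb R^2$). Then the $\delta$-PHO admits a first integral quadratic in the momenta if and only if one of the following holds. (I) $\delta\ge5$ is odd and $\operatorname{rank}\mathcal M(K^{(\delta)})=1$. (II) $\delta\ge4$ is even and either $\operatorname{rank}\mathcal M(K^{(\delta)})=1$, or $$v_0\ne0,\qquad v_{2h}=\frac{\binom{\delta/2}{h}}{\binom{\delta}{2h}}\,v_0,\qquad v_{2h-1}=0\qquad\Bigl(h=1,\dots,\tfrac{\delta}{2}\Bigr).$$ (III) $\delta=3$ and either $\operatorname{rank}\mathcal M(K^{(3)})=1$, or $$\operatorname{rank}\begin{pmatrix}7v_1&-v_0+6v_2&-2v_1+5v_3\\-5v_0+2v_2&-6v_1+v_3&-7v_2\end{pmatrix}=1.$$ -/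

import Mathlib

open scoped ContDiff

noncomputable section

namespace PHO

/-- The configuration plane, with coordinates `q 0`, `q 1` (written `q₁`, `q₂` in the text). -/
abbrev Config : Type := Fin 2 → ℝ

/-- The phase space, with points `(q, p)`. -/
abbrev Phase : Type := Config × Config

/-- The homogeneous potential `∑_{h=0}^{δ} v_h (δ choose h) q₁^h q₂^(δ-h)`.
Only the values `v h` with `h ≤ δ` enter. -/
def potential (δ : ℕ) (v : ℕ → ℝ) (q : Config) : ℝ :=
  ∑ h ∈ Finset.range (δ + 1), v h * (δ.choose h : ℝ) * q 0 ^ h * q 1 ^ (δ - h)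

/-- The Hamiltonian of the `δ`-PHO,
`½ (p₁² + q₁²) + ½ (p₂² + q₂²)` plus the homogeneous potential. -/
def hamiltonian (δ : ℕ) (v : ℕ → ℝ) (x : Phase) : ℝ :=
  (1 / 2 : ℝ) * ∑ j : Fin 2, (x.2 j ^ 2 + x.1 j ^ 2) + potential δ v x.1

/-- The partial derivative `∂F/∂q_j` at `x`. -/
def dq (F : Phase → ℝ) (j : Fin 2) (x : Phase) : ℝ :=
  fderiv ℝ F x (Pi.single j 1, 0)

/-- The partial derivative `∂F/∂p_j` at `x`. -/
def dp (F : Phase → ℝ) (j : Fin 2) (x : Phase) : ℝ :=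
  fderiv ℝ F x (0, Pi.single j 1)

/-- The canonical Poisson bracket `∑_j (∂F/∂q_j ∂G/∂p_j - ∂F/∂p_j ∂G/∂q_j)`. -/
def poissonBracket (F G : Phase → ℝ) (x : Phase) : ℝ :=
  ∑ j : Fin 2, (dq F j x * dp G j x - dp F j x * dq G j x)

/-- `F` is a polynomial of degree exactly two in the momenta, with smooth functions of the
positions as coefficients. Terms linear in the momenta and free of them are allowed. -/
def IsQuadraticInMomenta (F : Phase → ℝ) : Prop :=
  ∃ (a : Fin 2 → Fin 2 → Config → ℝ) (b : Fin 2 → Config → ℝ) (c : Config → ℝ),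
    (∀ i j, ContDiff ℝ ∞ (a i j)) ∧ (∀ i, ContDiff ℝ ∞ (b i)) ∧ ContDiff ℝ ∞ c ∧
    (∀ q p : Config,
      F (q, p) = (∑ i, ∑ j, a i j q * p i * p j) + (∑ i, b i q * p i) + c q) ∧
    ∃ q p : Config, (∑ i, ∑ j, a i j q * p i * p j) ≠ 0

/-- `F` and `G` are functionally independent: their differentials are not everywhere
linearly dependent. -/
def FunctionallyIndependent (F G : Phase → ℝ) : Prop :=
  ∃ x : Phase, LinearIndependent ℝ ![fderiv ℝ F x, fderiv ℝ G x]

/-- The system with Hamiltonian `K` admits a first integral that is quadratic in the momenta.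
As usual the integral is meant to be independent of the energy `K`, which is itself a conserved
quantity quadratic in the momenta. -/
def AdmitsQuadraticFirstIntegral (K : Phase → ℝ) : Prop :=
  ∃ F : Phase → ℝ, IsQuadraticInMomenta F ∧ (∀ x, poissonBracket F K x = 0) ∧
    FunctionallyIndependent F K

/-- The `2 × (δ - 1)` matrix with rows `v_h - v_{h+2}` and `2 v_{h+1}`, `h = 0, …, δ - 2`. -/
def matM (δ : ℕ) (v : ℕ → ℝ) : Matrix (Fin 2) (Fin (δ - 1)) ℝ :=
  Matrix.of ![fun h => v h - v (h + 2), fun h => 2 * v (h + 1)]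

/-- The additional `2 × 3` matrix for cubic potentials. -/
def matN (v : ℕ → ℝ) : Matrix (Fin 2) (Fin 3) ℝ :=
  !![7 * v 1, -v 0 + 6 * v 2, -2 * v 1 + 5 * v 3;
     -5 * v 0 + 2 * v 2, -6 * v 1 + v 3, -7 * v 2]

/-- The polar coefficient relations, for even `δ`. -/
def PolarRelations (δ : ℕ) (v : ℕ → ℝ) : Prop :=
  v 0 ≠ 0 ∧
  (∀ h ∈ Finset.Icc 1 (δ / 2),
    v (2 * h) = (((δ / 2).choose h : ℝ) / (δ.choose (2 * h) : ℝ)) * v 0) ∧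
  (∀ h ∈ Finset.Icc 1 (δ / 2), v (2 * h - 1) = 0)

end PHO

end

/-! Write `F = A p₁² + B p₁p₂ + D p₂² + b₀ p₁ + b₁ p₂ + c`. Its bracket with `½|p|² + U` is a cubic
in `p`, so it vanishes iff ten coefficients do. The cubic ones say that `(A, B, D)` is a Killing
tensor of the Euclidean plane, hence polynomial in `q` with six parameters α, β, β', γ, γ', η; the
quadratic ones say that `b` is a Killing vector; the linear ones prescribe `dc`, and `c` exists iff
the prescribed one-form is closed, which is the Bertrand–Darboux equation. Only μ = γ - γ' enters
it, since the trace part belongs to the Hamiltonian itself. An integral therefore exists iff a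
nonzero (α, β, β', μ, η) solves this equation (`admits_iff_bertrandDarboux`). The terms linear in
`p` add nothing: if they alone make `F` independent, they force a rotation-invariant potential, and
then α = 1 is a solution.

For δ = n + 2 the scaling `q ↦ τ q` splits the equation into degrees 1 (β, β' against the harmonic
term), n (μ, η), n + 1 (β, β' against the potential) and n + 2 (α). If n ≥ 2 these degrees are
distinct, so β = β' = 0, and what remains is a dependence between the rows of `matM` or a
rotation-invariant potential. The latter is a multiple of `(q₁² + q₂²)^(δ/2)`, and zero when δ is
odd.

If n = 1, degrees 1 and n coincide and β, β' may survive. The degree-two part is then a dependence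
between the rows of `matN`, while the degree-one part can be solved for μ, η when `matM` has rank
two; rank one of `matM` suffices by itself. -/

noncomputable section

namespace PHO

/-! ### Partial derivatives on the plane. -/

/-- The partial derivative `∂f/∂q_j` of a function of the positions. -/
def pd (j : Fin 2) (f : Config → ℝ) (q : Config) : ℝ :=
  fderiv ℝ f q (Pi.single j 1)

/-- `f` is differentiable at `q` with partial derivatives `a` and `b`. -/
def HasGrad (f : Config → ℝ) (a b : ℝ) (q : Config) : Prop :=
  HasFDerivAt f (a • (ContinuousLinearMap.proj 0 : Config →L[ℝ] ℝ) +
    b • (ContinuousLinearMap.proj 1 : Config →L[ℝ] ℝ)) q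

theorem vec_eq (w : Config) :
    w = w 0 • (Pi.single 0 1 : Config) + w 1 • (Pi.single 1 1 : Config) := by
  ext i
  fin_cases i <;> simp

theorem fderiv_apply_eq_pd (f : Config → ℝ) (q w : Config) :
    fderiv ℝ f q w = w 0 * pd 0 f q + w 1 * pd 1 f q := by
  conv_lhs => rw [vec_eq w, map_add, map_smul, map_smul]
  rfl

theorem hasGrad_of_differentiableAt {f : Config → ℝ} {q : Config}
    (h : DifferentiableAt ℝ f q) : HasGrad f (pd 0 f q) (pd 1 f q) q := by
  refine h.hasFDerivAt.congr_fderiv ?_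
  ext w
  simp [fderiv_apply_eq_pd, mul_comm]

namespace HasGrad

variable {f g : Config → ℝ} {a b a' b' : ℝ} {q : Config}

theorem pd_zero (h : HasGrad f a b q) : pd 0 f q = a := by
  rw [pd, HasFDerivAt.fderiv h]; simp

theorem pd_one (h : HasGrad f a b q) : pd 1 f q = b := by
  rw [pd, HasFDerivAt.fderiv h]; simp

theorem add (hf : HasGrad f a b q) (hg : HasGrad g a' b' q) :
    HasGrad (fun q => f q + g q) (a + a') (b + b') q := by
  refine (HasFDerivAt.add hf hg).congr_fderiv ?_
  ext w; simp; ring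

theorem mul (hf : HasGrad f a b q) (hg : HasGrad g a' b' q) :
    HasGrad (fun q => f q * g q) (a * g q + f q * a') (b * g q + f q * b') q := by
  refine (HasFDerivAt.mul hf hg).congr_fderiv ?_
  ext w; simp; ring

theorem const (k : ℝ) : HasGrad (fun _ => k) 0 0 q := by
  refine (hasFDerivAt_const k q).congr_fderiv ?_
  ext w; simp

theorem const_mul (k : ℝ) (hf : HasGrad f a b q) :
    HasGrad (fun q => k * f q) (k * a) (k * b) q := by
  refine (HasFDerivAt.const_mul hf k).congr_fderiv ?_
  ext w; simp; ring

theorem coord_zero : HasGrad (fun q => q 0) 1 0 q := by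
  refine (ContinuousLinearMap.proj (R := ℝ) (φ := fun _ : Fin 2 => ℝ) 0).hasFDerivAt.congr_fderiv ?_
  ext w; simp

theorem coord_one : HasGrad (fun q => q 1) 0 1 q := by
  refine (ContinuousLinearMap.proj (R := ℝ) (φ := fun _ : Fin 2 => ℝ) 1).hasFDerivAt.congr_fderiv ?_
  ext w; simp

theorem congr_grad (hf : HasGrad f a b q) (ha : a = a') (hb : b = b') : HasGrad f a' b' q :=
  ha ▸ hb ▸ hf

end HasGrad

/-! ### Homogeneous potentials in binomial normalisation. -/

/-- The sequence `v` with its first term removed. -/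
def shift (v : ℕ → ℝ) (h : ℕ) : ℝ := v (h + 1)

/-- Pascal's rule. With the binomial normalisation, `∂/∂q₁` shifts the coefficients and `∂/∂q₂`
drops the last one, both up to the factor given by the degree; hence this is Euler's identity. -/
theorem potential_succ (n : ℕ) (v : ℕ → ℝ) (q : Config) :
    potential (n + 1) v q = q 0 * potential n (shift v) q + q 1 * potential n v q := by
  have h1 : potential (n + 1) v q = v 0 * q 1 ^ (n + 1) +
      ∑ h ∈ Finset.range (n + 1),
        v (h + 1) * ((n + 1).choose (h + 1) : ℝ) * q 0 ^ (h + 1) * q 1 ^ (n - h) := by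
    rw [potential, Finset.sum_range_succ']
    simp [add_comm]
  have h2 : q 1 * potential n v q = v 0 * q 1 ^ (n + 1) +
      ∑ h ∈ Finset.range (n + 1),
        v (h + 1) * (n.choose (h + 1) : ℝ) * q 0 ^ (h + 1) * q 1 ^ (n - h) := by
    rw [potential, Finset.sum_range_succ', Finset.sum_range_succ _ n]
    simp only [Nat.choose_succ_self, Nat.cast_zero, mul_zero, zero_mul, add_zero]
    rw [mul_add, Finset.mul_sum, add_comm]
    congr 1
    · simp; ring
    · refine Finset.sum_congr rfl fun h hh => ?_
      obtain ⟨k, hk⟩ : ∃ k, n = h + 1 + k := ⟨n - (h + 1), by grind⟩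
      have e1 : n - (h + 1) = k := by omega
      have e2 : n - h = k + 1 := by omega
      rw [e1, e2]; ring
  rw [h1, h2, potential, Finset.mul_sum, ← add_assoc, add_comm _ (v 0 * _), add_assoc,
    ← Finset.sum_add_distrib]
  congr 1
  refine Finset.sum_congr rfl fun h _ => ?_
  rw [Nat.choose_succ_succ, shift]; push_cast; ring

theorem hasGrad_potential (n : ℕ) (v : ℕ → ℝ) (q : Config) :
    HasGrad (potential (n + 1) v) ((n + 1) * potential n (shift v) q)
      ((n + 1) * potential n v q) q := by
  induction n generalizing v with
  | zero =>
    have : potential (0 + 1) v = fun q => v 1 * q 0 + v 0 * q 1 := by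
      funext q; simp [potential, Finset.sum_range_succ]; ring
    rw [this]
    refine ((HasGrad.coord_zero.const_mul _).add (HasGrad.coord_one.const_mul _)).congr_grad ?_ ?_ <;>
      simp [potential, shift]
  | succ n ih =>
    have : potential (n + 1 + 1) v = fun q =>
        q 0 * potential (n + 1) (shift v) q + q 1 * potential (n + 1) v q :=
      funext (potential_succ _ v)
    rw [this]
    refine ((HasGrad.coord_zero.mul (ih _)).add (HasGrad.coord_one.mul (ih _))).congr_grad ?_ ?_
    · rw [potential_succ n (shift v)]; push_cast; ring
    · rw [potential_succ n v]; push_cast; ring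

theorem contDiff_potential (n : ℕ) (v : ℕ → ℝ) : ContDiff ℝ ∞ (potential n v) := by
  unfold potential; fun_prop

theorem potential_add (n : ℕ) (v w : ℕ → ℝ) (q : Config) :
    potential n (fun h => v h + w h) q = potential n v q + potential n w q := by
  simp only [potential, ← Finset.sum_add_distrib]
  exact Finset.sum_congr rfl fun _ _ => by ring

theorem potential_const_mul (n : ℕ) (k : ℝ) (v : ℕ → ℝ) (q : Config) :
    potential n (fun h => k * v h) q = k * potential n v q := by
  simp only [potential, Finset.mul_sum]
  exact Finset.sum_congr rfl fun _ _ => by ring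

theorem potential_smul (n : ℕ) (v : ℕ → ℝ) (t : ℝ) (q : Config) :
    potential n v (t • q) = t ^ n * potential n v q := by
  simp only [potential, Finset.mul_sum]
  refine Finset.sum_congr rfl fun h hh => ?_
  obtain ⟨k, rfl⟩ : ∃ k, n = h + k := ⟨n - h, by grind⟩
  simp [mul_pow, pow_add]; ring

/-- On the line `q₂ = 1` the form becomes a one-variable polynomial with coefficients `v_h (n choose
h)`. -/
theorem potential_eq_zero_iff (n : ℕ) (v : ℕ → ℝ) :
    (∀ q, potential n v q = 0) ↔ ∀ h ≤ n, v h = 0 := by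
  constructor
  · intro H h hh
    have hp : (∑ h ∈ Finset.range (n + 1),
        Polynomial.C (v h * (n.choose h : ℝ)) * Polynomial.X ^ h) = (0 : Polynomial ℝ) := by
      refine Polynomial.funext fun x => ?_
      have := H ![x, 1]
      simpa [potential, Polynomial.eval_finsetSum] using this
    have := congrArg (fun p => Polynomial.coeff p h) hp
    simp only [Polynomial.finsetSum_coeff, Polynomial.coeff_C_mul_X_pow] at this
    rw [Finset.sum_eq_single h (by intro b _ hb; rw [if_neg hb.symm]) (by grind)] at this
    have hc : (n.choose h : ℝ) ≠ 0 := by exact_mod_cast (Nat.choose_pos hh).ne'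
    simpa [hc] using this
  · intro H q
    exact Finset.sum_eq_zero fun h hh => by rw [H h (by grind)]; ring

/-! ### The Poincaré lemma. -/

/-- A closed smooth one-form `f dq₁ + g dq₂` on the plane is exact, and conversely. -/
theorem exists_primitive_iff {f g : Config → ℝ} (hf : ContDiff ℝ ∞ f) (hg : ContDiff ℝ ∞ g) :
    (∃ c : Config → ℝ, ContDiff ℝ ∞ c ∧ ∀ q, pd 0 c q = f q ∧ pd 1 c q = g q) ↔
      ∀ q, pd 1 f q = pd 0 g q := by
  set θ : Config → (Config →L[ℝ] ℝ) := fun q =>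
    f q • (ContinuousLinearMap.proj 0 : Config →L[ℝ] ℝ) +
      g q • (ContinuousLinearMap.proj 1 : Config →L[ℝ] ℝ) with hθ
  have hθs : ContDiff ℝ ∞ θ := by fun_prop
  have hd : ∀ q x y, fderiv ℝ θ q x y = fderiv ℝ f q x * y 0 + fderiv ℝ g q x * y 1 := by
    intro q x y
    have h1 := ((hf.differentiable (by simp)) q).hasFDerivAt.smul_const
      (ContinuousLinearMap.proj 0 : Config →L[ℝ] ℝ)
    have h2 := ((hg.differentiable (by simp)) q).hasFDerivAt.smul_const
      (ContinuousLinearMap.proj 1 : Config →L[ℝ] ℝ)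
    have h3 : HasFDerivAt θ _ q := h1.add h2
    rw [h3.fderiv]
    simp
  constructor
  · rintro ⟨c, hc, h⟩ q
    have hcθ : ∀ q, HasFDerivAt c (θ q) q := fun q => by
      have := hasGrad_of_differentiableAt ((hc.differentiable (by simp)) q)
      rw [(h q).1, (h q).2] at this
      exact this
    have := second_derivative_symmetric hcθ ((hθs.differentiable (by simp)) q).hasFDerivAt
      (Pi.single 1 1) (Pi.single 0 1)
    simpa [hd, pd] using this
  · intro h
    obtain ⟨c, hc⟩ := (convex_univ (𝕜 := ℝ) (E := Config)).exists_forall_hasFDerivAt_of_fderiv_symmetric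
       isOpen_univ (hθs.differentiable (by simp)).differentiableOn (by
        intro q _ x y
        rw [hd, hd, fderiv_apply_eq_pd, fderiv_apply_eq_pd, fderiv_apply_eq_pd, fderiv_apply_eq_pd,
          h q]
        ring)
    have hc' : ∀ q, HasGrad c (f q) (g q) q := fun q => hc q trivial
    -- The primitive is smooth because its derivative is the smooth form `θ`.
    refine ⟨c, contDiff_infty_iff_fderiv.2 ⟨fun q => (hc q trivial).differentiableAt, ?_⟩,
      fun q => ⟨(hc' q).pd_zero, (hc' q).pd_one⟩⟩
    rwa [funext fun q => (hc q trivial).fderiv]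

/-! ### Momentum-quadratic functions and their Poisson bracket with the energy. -/

/-- The function `A p₁² + B p₁ p₂ + D p₂² + b₀ p₁ + b₁ p₂ + c` on the phase space. -/
def momentumQuadratic (A B D b₀ b₁ c : Config → ℝ) (x : Phase) : ℝ :=
  A x.1 * x.2 0 ^ 2 + B x.1 * (x.2 0 * x.2 1) + D x.1 * x.2 1 ^ 2 + b₀ x.1 * x.2 0 +
    b₁ x.1 * x.2 1 + c x.1

theorem fderiv_momentumQuadratic {A B D b₀ b₁ c : Config → ℝ} {x : Phase}
    (hA : DifferentiableAt ℝ A x.1) (hB : DifferentiableAt ℝ B x.1)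
    (hD : DifferentiableAt ℝ D x.1) (h₀ : DifferentiableAt ℝ b₀ x.1)
    (h₁ : DifferentiableAt ℝ b₁ x.1) (hc : DifferentiableAt ℝ c x.1) (w : Phase) :
    fderiv ℝ (momentumQuadratic A B D b₀ b₁ c) x w =
      fderiv ℝ A x.1 w.1 * x.2 0 ^ 2 + fderiv ℝ B x.1 w.1 * (x.2 0 * x.2 1) +
      fderiv ℝ D x.1 w.1 * x.2 1 ^ 2 + fderiv ℝ b₀ x.1 w.1 * x.2 0 +
      fderiv ℝ b₁ x.1 w.1 * x.2 1 + fderiv ℝ c x.1 w.1 +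
      (2 * A x.1 * x.2 0 + B x.1 * x.2 1 + b₀ x.1) * w.2 0 +
      (B x.1 * x.2 0 + 2 * D x.1 * x.2 1 + b₁ x.1) * w.2 1 := by
  have lift : ∀ {f : Config → ℝ}, DifferentiableAt ℝ f x.1 →
      HasFDerivAt (fun y : Phase => f y.1)
        ((fderiv ℝ f x.1).comp (ContinuousLinearMap.fst ℝ Config Config)) x :=
    fun h => h.hasFDerivAt.comp x hasFDerivAt_fst
  have hp : ∀ j : Fin 2, HasFDerivAt (fun y : Phase => y.2 j)
      ((ContinuousLinearMap.proj j : Config →L[ℝ] ℝ).comp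
        (ContinuousLinearMap.snd ℝ Config Config)) x := fun j =>
    ((ContinuousLinearMap.proj j : Config →L[ℝ] ℝ).comp
        (ContinuousLinearMap.snd ℝ Config Config)).hasFDerivAt
  have key := ((((((lift hA).mul ((hp 0).pow 2)).add ((lift hB).mul ((hp 0).mul (hp 1)))).add
    ((lift hD).mul ((hp 1).pow 2))).add ((lift h₀).mul (hp 0))).add
    ((lift h₁).mul (hp 1))).add (lift hc)
  have key' : HasFDerivAt (momentumQuadratic A B D b₀ b₁ c) _ x := key
  rw [key'.fderiv]
  simp
  ring

/-- The potential energy of the `δ`-PHO. -/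
def energy (δ : ℕ) (v : ℕ → ℝ) (q : Config) : ℝ :=
  1 / 2 * (q 0 * q 0 + q 1 * q 1) + potential δ v q

theorem hamiltonian_eq (δ : ℕ) (v : ℕ → ℝ) :
    hamiltonian δ v = momentumQuadratic (fun _ => 1 / 2) (fun _ => 0) (fun _ => 1 / 2)
      (fun _ => 0) (fun _ => 0) (energy δ v) := by
  funext x
  simp [hamiltonian, momentumQuadratic, energy]
  ring

theorem isQuadraticInMomenta_iff (F : Phase → ℝ) :
    IsQuadraticInMomenta F ↔ ∃ A B D b₀ b₁ c : Config → ℝ,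
      (ContDiff ℝ ∞ A ∧ ContDiff ℝ ∞ B ∧ ContDiff ℝ ∞ D) ∧
      (ContDiff ℝ ∞ b₀ ∧ ContDiff ℝ ∞ b₁ ∧ ContDiff ℝ ∞ c) ∧
      F = momentumQuadratic A B D b₀ b₁ c ∧
      ∃ q p : Config, A q * p 0 ^ 2 + B q * (p 0 * p 1) + D q * p 1 ^ 2 ≠ 0 := by
  constructor
  · rintro ⟨a, b, c, ha, hb, hc, hF, q, p, hqp⟩
    refine ⟨a 0 0, fun q => a 0 1 q + a 1 0 q, a 1 1, b 0, b 1, c,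
      ⟨ha 0 0, (ha 0 1).add (ha 1 0), ha 1 1⟩, ⟨hb 0, hb 1, hc⟩, ?_, q, p, ?_⟩
    · funext x
      rw [hF x.1 x.2]
      simp [momentumQuadratic]
      ring
    · convert hqp using 1
      simp
      ring
  · rintro ⟨A, B, D, b₀, b₁, c, ⟨hA, hB, hD⟩, ⟨h₀, h₁, hc⟩, rfl, q, p, hqp⟩
    refine ⟨![![A, B], ![fun _ => 0, D]], ![b₀, b₁], c, ?_, ?_, hc, ?_, q, p, ?_⟩
    · intro i j
      fin_cases i <;> fin_cases j <;> simp [hA, hB, hD, contDiff_const]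
    · intro i
      fin_cases i <;> simp [h₀, h₁]
    · intro q p
      simp [momentumQuadratic]
      ring
    · convert hqp using 1
      simp
      ring

theorem cubic_eq_zero_iff (k₃₀ k₂₁ k₁₂ k₀₃ k₂₀ k₁₁ k₀₂ k₁₀ k₀₁ k₀₀ : ℝ) :
    (∀ p : Config, k₃₀ * p 0 ^ 3 + k₂₁ * (p 0 ^ 2 * p 1) + k₁₂ * (p 0 * p 1 ^ 2) +
      k₀₃ * p 1 ^ 3 + k₂₀ * p 0 ^ 2 + k₁₁ * (p 0 * p 1) + k₀₂ * p 1 ^ 2 + k₁₀ * p 0 +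
      k₀₁ * p 1 + k₀₀ = 0) ↔
    (k₃₀ = 0 ∧ k₂₁ = 0 ∧ k₁₂ = 0 ∧ k₀₃ = 0) ∧ (k₂₀ = 0 ∧ k₁₁ = 0 ∧ k₀₂ = 0) ∧
      (k₁₀ = 0 ∧ k₀₁ = 0) ∧ k₀₀ = 0 := by
  constructor
  · intro H
    -- The values at these ten momenta determine the ten coefficients.
    have h1 := H ![0, 0]
    have h2 := H ![1, 0]
    have h3 := H ![-1, 0]
    have h4 := H ![2, 0]
    have h5 := H ![0, 1]
    have h6 := H ![0, -1]
    have h7 := H ![0, 2]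
    have h8 := H ![1, 1]
    have h9 := H ![1, -1]
    have h10 := H ![-1, 1]
    simp at h1 h2 h3 h4 h5 h6 h7 h8 h9 h10
    refine ⟨⟨?_, ?_, ?_, ?_⟩, ⟨?_, ?_, ?_⟩, ⟨?_, ?_⟩, ?_⟩ <;> linarith
  · rintro ⟨⟨rfl, rfl, rfl, rfl⟩, ⟨rfl, rfl, rfl⟩, ⟨rfl, rfl⟩, rfl⟩ p
    simp

theorem hasGrad_energy (n : ℕ) (v : ℕ → ℝ) (q : Config) :
    HasGrad (energy (n + 1) v) (q 0 + (n + 1) * potential n (shift v) q)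
      (q 1 + (n + 1) * potential n v q) q := by
  refine ((((HasGrad.coord_zero.mul HasGrad.coord_zero).add
    (HasGrad.coord_one.mul HasGrad.coord_one)).const_mul (1 / 2)).add
    (hasGrad_potential n v q)).congr_grad ?_ ?_ <;> ring

theorem contDiff_energy (n : ℕ) (v : ℕ → ℝ) : ContDiff ℝ ∞ (energy n v) := by
  have := contDiff_potential n v
  unfold energy; fun_prop

/-- The equations expressing that a momentum-quadratic function Poisson-commutes with the
Hamiltonian `(p₁² + p₂²) / 2 + U`, where `U` has partial derivatives `U₀` and `U₁`. -/
structure CommutingSystem (A B D b₀ b₁ c U : Config → ℝ) (q : Config) : Prop where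
  kill₃₀ : pd 0 A q = 0
  kill₂₁ : pd 1 A q + pd 0 B q = 0
  kill₁₂ : pd 1 B q + pd 0 D q = 0
  kill₀₃ : pd 1 D q = 0
  kill₂₀ : pd 0 b₀ q = 0
  kill₁₁ : pd 1 b₀ q + pd 0 b₁ q = 0
  kill₀₂ : pd 1 b₁ q = 0
  grad₀ : pd 0 c q = 2 * A q * pd 0 U q + B q * pd 1 U q
  grad₁ : pd 1 c q = B q * pd 0 U q + 2 * D q * pd 1 U q
  lin : b₀ q * pd 0 U q + b₁ q * pd 1 U q = 0

theorem poissonBracket_eq_zero_iff {A B D b₀ b₁ c U : Config → ℝ} (q : Config)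
    (hA : DifferentiableAt ℝ A q) (hB : DifferentiableAt ℝ B q)
    (hD : DifferentiableAt ℝ D q) (h₀ : DifferentiableAt ℝ b₀ q)
    (h₁ : DifferentiableAt ℝ b₁ q) (hc : DifferentiableAt ℝ c q) (hU : DifferentiableAt ℝ U q) :
    (∀ p, poissonBracket (momentumQuadratic A B D b₀ b₁ c)
      (momentumQuadratic (fun _ => 1 / 2) (fun _ => 0) (fun _ => 1 / 2) (fun _ => 0)
        (fun _ => 0) U) (q, p) = 0) ↔ CommutingSystem A B D b₀ b₁ c U q := by
  have key : ∀ p, poissonBracket (momentumQuadratic A B D b₀ b₁ c)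
      (momentumQuadratic (fun _ => 1 / 2) (fun _ => 0) (fun _ => 1 / 2) (fun _ => 0)
        (fun _ => 0) U) (q, p) =
      pd 0 A q * p 0 ^ 3 + (pd 1 A q + pd 0 B q) * (p 0 ^ 2 * p 1) +
      (pd 1 B q + pd 0 D q) * (p 0 * p 1 ^ 2) + pd 1 D q * p 1 ^ 3 +
      pd 0 b₀ q * p 0 ^ 2 + (pd 1 b₀ q + pd 0 b₁ q) * (p 0 * p 1) + pd 1 b₁ q * p 1 ^ 2 +
      (pd 0 c q - (2 * A q * pd 0 U q + B q * pd 1 U q)) * p 0 +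
      (pd 1 c q - (B q * pd 0 U q + 2 * D q * pd 1 U q)) * p 1 +
      -(b₀ q * pd 0 U q + b₁ q * pd 1 U q) := by
    intro p
    simp only [poissonBracket, dq, dp, Fin.sum_univ_two]
    have hF := fderiv_momentumQuadratic (x := (q, p)) hA hB hD h₀ h₁ hc
    have hK := fderiv_momentumQuadratic (x := (q, p)) (A := fun _ => 1 / 2) (B := fun _ => 0)
      (D := fun _ => 1 / 2) (b₀ := fun _ => 0) (b₁ := fun _ => 0) (by fun_prop) (by fun_prop)
      (by fun_prop) (by fun_prop) (by fun_prop) hU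
    simp only [hF, hK]
    simp [pd]
    ring
  simp only [key, cubic_eq_zero_iff]
  constructor
  · rintro ⟨⟨h1, h2, h3, h4⟩, ⟨h5, h6, h7⟩, ⟨h8, h9⟩, h10⟩
    exact ⟨h1, h2, h3, h4, h5, h6, h7, sub_eq_zero.1 h8, sub_eq_zero.1 h9, neg_eq_zero.1 h10⟩
  · rintro ⟨h1, h2, h3, h4, h5, h6, h7, h8, h9, h10⟩
    exact ⟨⟨h1, h2, h3, h4⟩, ⟨h5, h6, h7⟩, ⟨sub_eq_zero.2 h8, sub_eq_zero.2 h9⟩,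
      neg_eq_zero.2 h10⟩

/-! ### Killing vectors and Killing tensors of the plane. -/

theorem hasDerivAt_slice_zero {f : Config → ℝ} (hf : Differentiable ℝ f) (t y : ℝ) :
    HasDerivAt (fun t => f ![t, y]) (pd 0 f ![t, y]) t := by
  have h1 : HasDerivAt (fun t : ℝ => (![t, y] : Config)) (Pi.single 0 1) t := by
    rw [hasDerivAt_pi]
    intro i
    fin_cases i
    · simpa using hasDerivAt_id' t
    · simpa using hasDerivAt_const t y
  exact (hf _).hasFDerivAt.comp_hasDerivAt t h1

theorem hasDerivAt_slice_one {f : Config → ℝ} (hf : Differentiable ℝ f) (x t : ℝ) :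
    HasDerivAt (fun t => f ![x, t]) (pd 1 f ![x, t]) t := by
  have h1 : HasDerivAt (fun t : ℝ => (![x, t] : Config)) (Pi.single 1 1) t := by
    rw [hasDerivAt_pi]
    intro i
    fin_cases i
    · simpa using hasDerivAt_const t x
    · simpa using hasDerivAt_id' t
  exact (hf _).hasFDerivAt.comp_hasDerivAt t h1

theorem eq_quadratic_of_deriv_affine {f : ℝ → ℝ} {k l : ℝ}
    (h : ∀ t, HasDerivAt f (k + l * t) t) (t : ℝ) : f t = f 0 + k * t + l / 2 * t ^ 2 := by
  have hg : ∀ t, HasDerivAt (fun t => f t - (k * t + l / 2 * t ^ 2)) 0 t := fun t => by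
    refine ((h t).sub (((hasDerivAt_id t).const_mul k).add
      (((hasDerivAt_id t).pow 2).const_mul (l / 2)))).congr_deriv ?_
    simp; ring
  have := is_const_of_deriv_eq_zero (fun t => (hg t).differentiableAt)
    (fun t => (hg t).deriv) t 0
  simp at this
  linarith

theorem slice_zero_of_pd_eq {f : Config → ℝ} (hf : Differentiable ℝ f) {k : ℝ} {y : ℝ}
    (h : ∀ t, pd 0 f ![t, y] = k) (t : ℝ) : f ![t, y] = f ![0, y] + k * t := by
  have := eq_quadratic_of_deriv_affine (k := k) (l := 0)
    (fun t => (hasDerivAt_slice_zero hf t y).congr_deriv (by rw [h]; ring)) t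
  simpa using this

theorem slice_one_of_pd_eq {f : Config → ℝ} (hf : Differentiable ℝ f) {k : ℝ} {x : ℝ}
    (h : ∀ t, pd 1 f ![x, t] = k) (t : ℝ) : f ![x, t] = f ![x, 0] + k * t := by
  have := eq_quadratic_of_deriv_affine (k := k) (l := 0)
    (fun t => (hasDerivAt_slice_one hf x t).congr_deriv (by rw [h]; ring)) t
  simpa using this

theorem pd_zero_eq_of_slices {f g : Config → ℝ} (hf : Differentiable ℝ f)
    (hg : Differentiable ℝ g) {x y z : ℝ} (h : ∀ t, f ![t, y] = g ![t, z]) :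
    pd 0 f ![x, y] = pd 0 g ![x, z] :=
  (hasDerivAt_slice_zero hf x y).unique
    ((hasDerivAt_slice_zero hg x z).congr_of_eventuallyEq (.of_forall h))

theorem pd_one_eq_of_slices {f g : Config → ℝ} (hf : Differentiable ℝ f)
    (hg : Differentiable ℝ g) {x y z : ℝ} (h : ∀ t, f ![y, t] = g ![z, t]) :
    pd 1 f ![y, x] = pd 1 g ![z, x] :=
  (hasDerivAt_slice_one hf y x).unique
    ((hasDerivAt_slice_one hg z x).congr_of_eventuallyEq (.of_forall h))

theorem config_eta (q : Config) : q = ![q 0, q 1] := by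
  ext i; fin_cases i <;> rfl

/-- Killing vectors of the Euclidean plane. -/
theorem killing_vector {f g : Config → ℝ} (hf : Differentiable ℝ f) (hg : Differentiable ℝ g)
    (h1 : ∀ q, pd 0 f q = 0) (h2 : ∀ q, pd 1 f q + pd 0 g q = 0) (h3 : ∀ q, pd 1 g q = 0) :
    ∃ s t w : ℝ, ∀ q, f q = s + w * q 1 ∧ g q = t - w * q 0 := by
  -- `f` depends on `q₂` alone and `g` on `q₁` alone, so their derivatives, being opposite
  -- everywhere, are constant.
  have f0 : ∀ x y, f ![x, y] = f ![0, y] := fun x y => by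
    simpa using slice_zero_of_pd_eq hf (y := y) (fun t => h1 _) x
  have g0 : ∀ x y, g ![x, y] = g ![x, 0] := fun x y => by
    simpa using slice_one_of_pd_eq hg (x := x) (fun t => h3 _) y
  have f1 : ∀ x y z, pd 1 f ![x, y] = pd 1 f ![z, y] := fun x y z =>
    pd_one_eq_of_slices hf hf fun t => by rw [f0 x, f0 z]
  have g1 : ∀ x y z, pd 0 g ![x, y] = pd 0 g ![x, z] := fun x y z =>
    pd_zero_eq_of_slices hg hg fun t => by rw [g0 _ y, g0 _ z]
  have e1 : ∀ x y, pd 0 g ![x, y] = -pd 1 f ![0, 0] := fun x y => by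
    have := h2 ![x, 0]
    rw [g1 x y 0]
    rw [f1 x 0 0] at this
    linarith
  have e2 : ∀ x y, pd 1 f ![x, y] = pd 1 f ![0, 0] := fun x y => by
    have := h2 ![x, y]
    rw [e1] at this
    linarith
  refine ⟨f ![0, 0], g ![0, 0], pd 1 f ![0, 0], fun q => ?_⟩
  rw [config_eta q]
  constructor
  · rw [f0, slice_one_of_pd_eq hf (fun t => e2 0 t)]; simp
  · rw [g0, slice_zero_of_pd_eq hg (fun t => e1 t 0)]; simp; ring

/-- Killing tensors of valence two of the Euclidean plane. -/
theorem killing_tensor {A B D : Config → ℝ} (hA : Differentiable ℝ A) (hB : Differentiable ℝ B)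
    (hD : Differentiable ℝ D) (h1 : ∀ q, pd 0 A q = 0) (h2 : ∀ q, pd 1 A q + pd 0 B q = 0)
    (h3 : ∀ q, pd 1 B q + pd 0 D q = 0) (h4 : ∀ q, pd 1 D q = 0) :
    ∃ α β β' γ γ' η : ℝ, ∀ q, A q = α * q 1 ^ 2 + β * q 1 + γ ∧
      B q = -2 * α * (q 0 * q 1) - β * q 0 - β' * q 1 + η ∧
      D q = α * q 0 ^ 2 + β' * q 0 + γ' := by
  have A0 : ∀ x y, A ![x, y] = A ![0, y] := fun x y => by
    simpa using slice_zero_of_pd_eq hA (y := y) (fun t => h1 _) x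
  have D0 : ∀ x y, D ![x, y] = D ![x, 0] := fun x y => by
    simpa using slice_one_of_pd_eq hD (x := x) (fun t => h4 _) y
  have A1 : ∀ x y z, pd 1 A ![x, y] = pd 1 A ![z, y] := fun x y z =>
    pd_one_eq_of_slices hA hA fun t => by rw [A0 x, A0 z]
  have D1 : ∀ x y z, pd 0 D ![x, y] = pd 0 D ![x, z] := fun x y z =>
    pd_zero_eq_of_slices hD hD fun t => by rw [D0 _ y, D0 _ z]
  have B0 : ∀ x y, B ![x, y] = B ![0, y] - pd 1 A ![0, y] * x := fun x y => by
    rw [slice_zero_of_pd_eq hB (y := y) (k := - pd 1 A ![0, y])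
      (fun t => by have := h2 ![t, y]; rw [A1 t y 0] at this; linarith) x]
    ring
  have B1 : ∀ x y, B ![x, y] = B ![x, 0] - pd 0 D ![x, 0] * y := fun x y => by
    rw [slice_one_of_pd_eq hB (x := x) (k := - pd 0 D ![x, 0])
      (fun t => by have := h3 ![x, t]; rw [D1 x t 0] at this; linarith) y]
    ring
  -- `B` is affine along each axis direction. Reaching `(x, y)` from the origin by the two
  -- axis-parallel paths gives this functional equation; at `x = 1` and at `y = 1` it makes the
  -- derivatives of `A` and `D` affine with the same slope, without differentiating twice.
  have K : ∀ x y, pd 0 D ![0, 0] * y + pd 1 A ![0, y] * x =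
      pd 1 A ![0, 0] * x + pd 0 D ![x, 0] * y := fun x y => by
    have e1 := B0 x y
    have e2 := B1 x y
    have e3 := B0 x 0
    have e4 := B1 0 y
    linarith
  set β := pd 1 A ![0, 0] with hβ
  set β' := pd 0 D ![0, 0] with hβ'
  have KA : ∀ y, pd 1 A ![0, y] = β + (pd 0 D ![1, 0] - β') * y := fun y => by
    have := K 1 y; linarith
  have KD : ∀ x, pd 0 D ![x, 0] = β' + (pd 0 D ![1, 0] - β') * x := fun x => by
    have := K x 1; rw [KA] at this; linarith
  refine ⟨(pd 0 D ![1, 0] - β') / 2, β, β', A ![0, 0], D ![0, 0], B ![0, 0], fun q => ?_⟩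
  rw [config_eta q]
  refine ⟨?_, ?_, ?_⟩
  · rw [A0, eq_quadratic_of_deriv_affine (f := fun t => A ![0, t])
      (fun t => (hasDerivAt_slice_one hA 0 t).congr_deriv (KA t)) (q 1)]
    simp; ring
  · rw [B0, B1, KA]
    simp; ring
  · rw [D0, eq_quadratic_of_deriv_affine (f := fun t => D ![t, 0])
      (fun t => (hasDerivAt_slice_zero hD t 0).congr_deriv (KD t)) (q 0)]
    simp; ring

/-- Coefficient of `p₁²` in the general quadratic Killing tensor of the plane. -/
def killA (α β γ : ℝ) (q : Config) : ℝ := α * (q 1 * q 1) + β * q 1 + γ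

/-- Coefficient of `p₁ p₂` in the general quadratic Killing tensor of the plane. -/
def killB (α β β' η : ℝ) (q : Config) : ℝ :=
  -2 * α * (q 0 * q 1) + -β * q 0 + -β' * q 1 + η

/-- Coefficient of `p₂²` in the general quadratic Killing tensor of the plane. -/
def killD (α β' γ' : ℝ) (q : Config) : ℝ := α * (q 0 * q 0) + β' * q 0 + γ'

theorem hasGrad_killA (α β γ : ℝ) (q : Config) :
    HasGrad (killA α β γ) 0 (2 * α * q 1 + β) q := by
  refine ((((HasGrad.coord_one.mul HasGrad.coord_one).const_mul α).add
    (HasGrad.coord_one.const_mul β)).add (HasGrad.const γ)).congr_grad ?_ ?_ <;> ring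

theorem hasGrad_killB (α β β' η : ℝ) (q : Config) :
    HasGrad (killB α β β' η) (-2 * α * q 1 - β) (-2 * α * q 0 - β') q := by
  refine (((((HasGrad.coord_zero.mul HasGrad.coord_one).const_mul (-2 * α)).add
    (HasGrad.coord_zero.const_mul (-β))).add
    (HasGrad.coord_one.const_mul (-β'))).add (HasGrad.const η)).congr_grad ?_ ?_ <;> ring

theorem hasGrad_killD (α β' γ' : ℝ) (q : Config) :
    HasGrad (killD α β' γ') (2 * α * q 0 + β') 0 q := by
  refine ((((HasGrad.coord_zero.mul HasGrad.coord_zero).const_mul α).add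
    (HasGrad.coord_zero.const_mul β')).add (HasGrad.const γ')).congr_grad ?_ ?_ <;> ring

theorem contDiff_killA (α β γ : ℝ) : ContDiff ℝ ∞ (killA α β γ) := by
  unfold killA; fun_prop

theorem contDiff_killB (α β β' η : ℝ) : ContDiff ℝ ∞ (killB α β β' η) := by
  unfold killB; fun_prop

theorem contDiff_killD (α β' γ' : ℝ) : ContDiff ℝ ∞ (killD α β' γ') := by
  unfold killD; fun_prop

/-! ### The Bertrand–Darboux equation. -/

/-- The angular derivative of the potential `potential (n + 2) v`, divided by `n + 2`,
up to sign. -/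
def rotational (n : ℕ) (v : ℕ → ℝ) (q : Config) : ℝ :=
  q 1 * potential (n + 1) (shift v) q - q 0 * potential (n + 1) v q

/-- The part of the Bertrand–Darboux expression coming from the constant part of the Killing
tensor. -/
def bdConst (n : ℕ) (v : ℕ → ℝ) (μ η : ℝ) (q : Config) : ℝ :=
  (n + 2) * (n + 1) * (2 * μ * potential n (shift v) q +
    η * (potential n v q - potential n (shift (shift v)) q))

/-- The part of the Bertrand–Darboux expression coming from the linear part of the Killing
tensor and the anharmonic potential. -/
def bdLinear (n : ℕ) (v : ℕ → ℝ) (β β' : ℝ) (q : Config) : ℝ :=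
  (n + 2) * (n + 1) * (2 * (β * q 1 - β' * q 0) * potential n (shift v) q -
    (β * q 0 + β' * q 1) * (potential n v q - potential n (shift (shift v)) q)) +
  3 * (n + 2) * (β * potential (n + 1) (shift v) q - β' * potential (n + 1) v q)

/-- The Bertrand–Darboux expression of a Killing tensor for the `(n + 2)`-PHO. -/
def bertrandDarboux (n : ℕ) (v : ℕ → ℝ) (α β β' μ η : ℝ) (q : Config) : ℝ :=
  3 * (β * q 0 - β' * q 1) + bdConst n v μ η q + bdLinear n v β β' q +
    2 * (n + 2) * (n + 4) * α * rotational n v q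

/-- The right-hand side is the closedness of the form prescribed for `dc`. The harmonic term meets
only β and β', because the isotropic oscillator already admits every constant tensor and the squared
angular momentum. -/
theorem exists_primitive_iff_bertrandDarboux (n : ℕ) (v : ℕ → ℝ) (α β β' γ γ' η : ℝ) :
    (∃ c : Config → ℝ, ContDiff ℝ ∞ c ∧ ∀ q,
      pd 0 c q = 2 * killA α β γ q * pd 0 (energy (n + 2) v) q +
        killB α β β' η q * pd 1 (energy (n + 2) v) q ∧
      pd 1 c q = killB α β β' η q * pd 0 (energy (n + 2) v) q +
        2 * killD α β' γ' q * pd 1 (energy (n + 2) v) q) ↔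
    ∀ q, bertrandDarboux n v α β β' (γ - γ') η q = 0 := by
  have hU0 : ∀ q, pd 0 (energy (n + 2) v) q =
      q 0 + (n + 2) * potential (n + 1) (shift v) q := fun q => by
    rw [(hasGrad_energy (n + 1) v q).pd_zero]; push_cast; ring
  have hU1 : ∀ q, pd 1 (energy (n + 2) v) q =
      q 1 + (n + 2) * potential (n + 1) v q := fun q => by
    rw [(hasGrad_energy (n + 1) v q).pd_one]; push_cast; ring
  have e0 := contDiff_potential (n + 1) (shift v)
  have e1 := contDiff_potential (n + 1) v
  have eA := contDiff_killA α β γ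
  have eB := contDiff_killB α β β' η
  have eD := contDiff_killD α β' γ'
  simp only [hU0, hU1]
  rw [exists_primitive_iff (by fun_prop) (by fun_prop)]
  refine forall_congr' fun q => ?_
  have gU0 := HasGrad.coord_zero.add ((hasGrad_potential n (shift v) q).const_mul ((n : ℝ) + 2))
  have gU1 := HasGrad.coord_one.add ((hasGrad_potential n v q).const_mul ((n : ℝ) + 2))
  rw [((((hasGrad_killA α β γ q).const_mul 2).mul gU0).add
      ((hasGrad_killB α β β' η q).mul gU1)).pd_one,
    (((hasGrad_killB α β β' η q).mul gU0).add
      (((hasGrad_killD α β' γ' q).const_mul 2).mul gU1)).pd_zero, ← sub_eq_zero]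
  refine Eq.congr ?_ rfl
  -- Rewriting degree `n + 1` through degree `n` brings in Euler's identity, after which both sides
  -- agree as polynomials.
  simp only [bertrandDarboux, bdConst, bdLinear, rotational, killA, killB, killD,
    potential_succ n]
  ring

/-! ### First integrals versus solutions of the Bertrand–Darboux equation. -/

theorem functionallyIndependent_of_dp {F G : Phase → ℝ} {x : Phase}
    (h : dp F 0 x * dp G 1 x - dp F 1 x * dp G 0 x ≠ 0) : FunctionallyIndependent F G := by
  refine ⟨x, LinearIndependent.pair_iff.2 fun s t hst => ?_⟩
  have h0 : s * dp F 0 x + t * dp G 0 x = 0 := by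
    simpa [dp] using congrArg (fun φ => φ ((0 : Config), (Pi.single 0 1 : Config))) hst
  have h1 : s * dp F 1 x + t * dp G 1 x = 0 := by
    simpa [dp] using congrArg (fun φ => φ ((0 : Config), (Pi.single 1 1 : Config))) hst
  constructor
  · refine (mul_eq_zero.1 ?_).resolve_right h
    linear_combination dp G 1 x * h0 - dp G 0 x * h1
  · refine (mul_eq_zero.1 ?_).resolve_right h
    linear_combination dp F 0 x * h1 - dp F 1 x * h0

theorem admits_of_bertrandDarboux (n : ℕ) (v : ℕ → ℝ) (α β β' μ η : ℝ)
    (hne : ¬ (α = 0 ∧ β = 0 ∧ β' = 0 ∧ μ = 0 ∧ η = 0))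
    (h : ∀ q, bertrandDarboux n v α β β' μ η q = 0) :
    AdmitsQuadraticFirstIntegral (hamiltonian (n + 2) v) := by
  have h' : ∀ q, bertrandDarboux n v α β β' (μ - 0) η q = 0 := by simpa using h
  obtain ⟨c, hc, hgrad⟩ := (exists_primitive_iff_bertrandDarboux n v α β β' μ 0 η).2 h'
  have dA := (contDiff_killA α β μ).differentiable (by simp)
  have dB := (contDiff_killB α β β' η).differentiable (by simp)
  have dD := (contDiff_killD α β' 0).differentiable (by simp)
  have dc := hc.differentiable (by simp)
  have dU := (contDiff_energy (n + 2) v).differentiable (by simp)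
  -- If the tensor were a multiple of the identity at all corners of the unit square, every
  -- parameter would vanish.
  obtain ⟨q, hq⟩ : ∃ q, killB α β β' η q ≠ 0 ∨ killA α β μ q ≠ killD α β' 0 q := by
    by_contra! hcon
    have h1 := hcon ![0, 0]
    have h2 := hcon ![1, 0]
    have h3 := hcon ![0, 1]
    have h4 := hcon ![1, 1]
    simp [killA, killB, killD] at h1 h2 h3 h4
    refine hne ⟨?_, ?_, ?_, ?_, ?_⟩ <;> linarith
  -- This is the minor of the momentum derivatives of `F` and `K`, which also certifies independence
  -- below.
  have hdp : ∃ p : Config, 2 * (killA α β μ q - killD α β' 0 q) * (p 0 * p 1) +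
      killB α β β' η q * (p 1 ^ 2 - p 0 ^ 2) ≠ 0 := by
    rcases hq with hq | hq
    · exact ⟨![1, 0], by simpa using hq⟩
    · exact ⟨![1, 1], by simpa [sub_eq_zero] using hq⟩
  obtain ⟨p, hp⟩ := hdp
  refine ⟨momentumQuadratic (killA α β μ) (killB α β β' η) (killD α β' 0) (fun _ => 0)
    (fun _ => 0) c, (isQuadraticInMomenta_iff _).2 ⟨_, _, _, _, _, _,
      ⟨contDiff_killA α β μ, contDiff_killB α β β' η, contDiff_killD α β' 0⟩,
      ⟨contDiff_const, contDiff_const, hc⟩, rfl, ?_⟩, ?_, ?_⟩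
  · refine ⟨q, ?_⟩
    by_contra! hcon
    have h1 := hcon ![1, 0]
    have h2 := hcon ![0, 1]
    have h3 := hcon ![1, 1]
    simp at h1 h2 h3
    refine hp ?_
    rw [h1, h2] at h3
    have h4 : killB α β β' η q = 0 := by linarith
    simp [h1, h2, h4]
  · rintro ⟨q, p⟩
    rw [hamiltonian_eq]
    refine (poissonBracket_eq_zero_iff q (dA q) (dB q) (dD q) (by fun_prop) (by fun_prop) (dc q)
      (dU q)).2 ⟨?_, ?_, ?_, ?_, ?_, ?_, ?_, (hgrad q).1, (hgrad q).2, by simp⟩ p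
    · exact (hasGrad_killA _ _ _ q).pd_zero
    · rw [(hasGrad_killA _ _ _ q).pd_one, (hasGrad_killB _ _ _ _ q).pd_zero]; ring
    · rw [(hasGrad_killB _ _ _ _ q).pd_one, (hasGrad_killD _ _ _ q).pd_zero]; ring
    · exact (hasGrad_killD _ _ _ q).pd_one
    · exact (HasGrad.const 0).pd_zero
    · rw [(HasGrad.const 0).pd_one, (HasGrad.const 0).pd_zero]; ring
    · exact (HasGrad.const 0).pd_one
  · refine functionallyIndependent_of_dp (x := (q, p)) ?_
    have hF := fderiv_momentumQuadratic (x := (q, p)) (b₀ := fun _ => 0) (b₁ := fun _ => 0)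
      (dA q) (dB q) (dD q) (by fun_prop) (by fun_prop) (dc q)
    have hK := fderiv_momentumQuadratic (x := (q, p)) (A := fun _ => 1 / 2) (B := fun _ => 0)
      (D := fun _ => 1 / 2) (b₀ := fun _ => 0) (b₁ := fun _ => 0) (by fun_prop) (by fun_prop)
      (by fun_prop) (by fun_prop) (by fun_prop) (dU q)
    rw [hamiltonian_eq]
    simp only [dp, hF, hK]
    convert hp using 1
    simp
    ring

/-- Separation by degree; the exponents 1 and `n` collide exactly when `n = 1`, the source of the
exceptional cubic case. -/
theorem coeffs_eq_zero {n : ℕ} (hn : 1 ≤ n) {a b c d : ℝ}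
    (h : ∀ t : ℝ, t * a + t ^ n * b + t ^ (n + 1) * c + t ^ (n + 2) * d = 0) :
    c = 0 ∧ d = 0 ∧ (n = 1 → a + b = 0) ∧ (2 ≤ n → a = 0 ∧ b = 0) := by
  have hp : (Polynomial.C a * Polynomial.X ^ 1 + Polynomial.C b * Polynomial.X ^ n +
      Polynomial.C c * Polynomial.X ^ (n + 1) + Polynomial.C d * Polynomial.X ^ (n + 2) :
      Polynomial ℝ) = 0 := by
    refine Polynomial.funext fun t => ?_
    have := h t
    simp only [Polynomial.eval_add, Polynomial.eval_mul, Polynomial.eval_C, Polynomial.eval_pow,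
      Polynomial.eval_X, Polynomial.eval_zero]
    linarith
  have hk : ∀ k, (if k = 1 then a else 0) + (if k = n then b else 0) +
      (if k = n + 1 then c else 0) + (if k = n + 2 then d else 0) = 0 := fun k => by
    have := congrArg (fun p => Polynomial.coeff p k) hp
    simpa only [Polynomial.coeff_add, Polynomial.coeff_C_mul_X_pow, Polynomial.coeff_zero]
      using this
  have h1 := hk 1
  have h2 := hk n
  have h3 := hk (n + 1)
  have h4 := hk (n + 2)
  refine ⟨?_, ?_, ?_, ?_⟩ <;> grind

theorem admits_iff_bertrandDarboux {n : ℕ} (hn : 1 ≤ n) (v : ℕ → ℝ) :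
    AdmitsQuadraticFirstIntegral (hamiltonian (n + 2) v) ↔
      ∃ α β β' μ η : ℝ, ¬ (α = 0 ∧ β = 0 ∧ β' = 0 ∧ μ = 0 ∧ η = 0) ∧
        ∀ q, bertrandDarboux n v α β β' μ η q = 0 := by
  refine ⟨?_, fun ⟨α, β, β', μ, η, hne, h⟩ => admits_of_bertrandDarboux n v α β β' μ η hne h⟩
  rintro ⟨F, hF, hbr, hind⟩
  obtain ⟨A, B, D, b₀, b₁, c, ⟨hA, hB, hD⟩, ⟨h₀, h₁, hc⟩, rfl, -⟩ :=
    (isQuadraticInMomenta_iff F).1 hF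
  have dA := hA.differentiable (by simp)
  have dB := hB.differentiable (by simp)
  have dD := hD.differentiable (by simp)
  have d0 := h₀.differentiable (by simp)
  have d1 := h₁.differentiable (by simp)
  have dc := hc.differentiable (by simp)
  have dU := (contDiff_energy (n + 2) v).differentiable (by simp)
  rw [hamiltonian_eq] at hbr hind
  have sys : ∀ q, CommutingSystem A B D b₀ b₁ c (energy (n + 2) v) q := fun q =>
    (poissonBracket_eq_zero_iff q (dA q) (dB q) (dD q) (d0 q) (d1 q) (dc q) (dU q)).1
      fun p => hbr (q, p)
  obtain ⟨α, β, β', γ, γ', η, hkill⟩ := killing_tensor dA dB dD (fun q => (sys q).kill₃₀)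
    (fun q => (sys q).kill₂₁) (fun q => (sys q).kill₁₂) (fun q => (sys q).kill₀₃)
  obtain ⟨s, t, w, hvec⟩ := killing_vector d0 d1 (fun q => (sys q).kill₂₀)
    (fun q => (sys q).kill₁₁) (fun q => (sys q).kill₀₂)
  obtain rfl : A = killA α β γ := funext fun q => by rw [(hkill q).1, killA]; ring
  obtain rfl : B = killB α β β' η := funext fun q => by rw [(hkill q).2.1, killB]; ring
  obtain rfl : D = killD α β' γ' := funext fun q => by rw [(hkill q).2.2, killD]; ring
  have hBD := (exists_primitive_iff_bertrandDarboux n v α β β' γ γ' η).1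
    ⟨c, hc, fun q => ⟨(sys q).grad₀, (sys q).grad₁⟩⟩
  by_cases hne : α = 0 ∧ β = 0 ∧ β' = 0 ∧ γ - γ' = 0 ∧ η = 0
  swap
  · exact ⟨α, β, β', γ - γ', η, hne, hBD⟩
  obtain ⟨rfl, rfl, rfl, hγ, rfl⟩ := hne
  have hlin : ∀ q : Config, s * q 0 + t * q 1 = 0 ∧ w * rotational n v q = 0 := fun q => by
    -- The rotation annihilates the harmonic term, so degree 1 sees only the translation `(s, t)`
    -- and degree `n + 2` only the rotation `w`; nothing occurs in degree `n`.
    have hscale : ∀ τ : ℝ, τ * (s * q 0 + t * q 1) + τ ^ n * 0 +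
        τ ^ (n + 1) * ((n + 2) * (s * potential (n + 1) (shift v) q +
          t * potential (n + 1) v q)) +
        τ ^ (n + 2) * ((n + 2) * (w * rotational n v q)) = 0 := fun τ => by
      have := (sys (τ • q)).lin
      rw [(hvec _).1, (hvec _).2, (hasGrad_energy (n + 1) v _).pd_zero,
        (hasGrad_energy (n + 1) v _).pd_one, potential_smul, potential_smul] at this
      simp only [Pi.smul_apply, smul_eq_mul] at this
      push_cast at this
      rw [rotational]
      linear_combination this
    have hs := coeffs_eq_zero hn hscale
    refine ⟨?_, ?_⟩
    · rcases hn.eq_or_lt with h1 | h1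
      · have := hs.2.2.1 h1.symm; linarith
      · exact (hs.2.2.2 h1).1
    · exact (mul_eq_zero.1 hs.2.1).resolve_left (by positivity)
  have hs : s = 0 := by simpa using (hlin ![1, 0]).1
  have ht : t = 0 := by simpa using (hlin ![0, 1]).1
  by_cases hw : w = 0
  · exfalso
    obtain ⟨x, hx⟩ := hind
    have hγ' : γ' = γ := by linarith
    subst hs ht hw hγ'
    rw [LinearIndependent.pair_iff] at hx
    -- With `b = 0` and a constant scalar tensor, `dF = 2γ' dK` everywhere.
    refine one_ne_zero (hx 1 (-2 * γ') ?_).1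
    have e0 : b₀ = fun _ => 0 := funext fun q => by rw [(hvec q).1]; ring
    have e1 : b₁ = fun _ => 0 := funext fun q => by rw [(hvec q).2]; ring
    have eA : killA 0 0 γ' = fun _ => γ' := funext fun q => by simp [killA]
    have eB : killB 0 0 0 0 = fun _ => 0 := funext fun q => by simp [killB]
    have eD : killD 0 0 γ' = fun _ => γ' := funext fun q => by simp [killD]
    have g0 := (sys x.1).grad₀
    have g1 := (sys x.1).grad₁
    rw [e0, e1, eA, eB, eD]
    rw [eA, eB] at g0
    rw [eB, eD] at g1
    refine ContinuousLinearMap.ext fun y => ?_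
    simp only [add_apply, smul_apply, smul_eq_mul,
      zero_apply]
    rw [fderiv_momentumQuadratic (by fun_prop) (by fun_prop) (by fun_prop) (by fun_prop)
        (by fun_prop) (dc _),
      fderiv_momentumQuadratic (by fun_prop) (by fun_prop) (by fun_prop) (by fun_prop)
        (by fun_prop) (dU _), fderiv_apply_eq_pd c, fderiv_apply_eq_pd (energy _ _), g0, g1]
    simp
    ring
  -- Angular momentum is conserved here, so its square supplies the solution α = 1.
  · refine ⟨1, 0, 0, 0, 0, by simp, fun q => ?_⟩
    have := (mul_eq_zero.1 (hlin q).2).resolve_left hw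
    simp [bertrandDarboux, bdConst, bdLinear, this]

theorem bertrandDarboux_split {n : ℕ} (hn : 1 ≤ n) {v : ℕ → ℝ} {α β β' μ η : ℝ}
    (h : ∀ q, bertrandDarboux n v α β β' μ η q = 0) (q : Config) :
    bdLinear n v β β' q = 0 ∧ α * rotational n v q = 0 ∧
      (n = 1 → 3 * (β * q 0 - β' * q 1) + bdConst n v μ η q = 0) ∧
      (2 ≤ n → β * q 0 - β' * q 1 = 0 ∧ bdConst n v μ η q = 0) := by
  have hs := coeffs_eq_zero hn (a := 3 * (β * q 0 - β' * q 1)) (b := bdConst n v μ η q)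
    (c := bdLinear n v β β' q) (d := 2 * (n + 2) * (n + 4) * (α * rotational n v q))
    fun τ => by
      rw [← h (τ • q)]
      simp only [bertrandDarboux, bdConst, bdLinear, rotational, potential_smul, Pi.smul_apply,
        smul_eq_mul]
      ring
  exact ⟨hs.1, (mul_eq_zero.1 hs.2.1).resolve_left (by positivity), hs.2.2.1,
    fun h2 => ⟨by have := (hs.2.2.2 h2).1; linarith, (hs.2.2.2 h2).2⟩⟩

/-! ### Rank one for matrices with two rows. -/

/-- A matrix with two rows has rank one iff it is nonzero and its rows are dependent. -/
theorem rank_eq_one_iff {k : ℕ} (M : Matrix (Fin 2) (Fin k) ℝ) :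
    M.rank = 1 ↔ M ≠ 0 ∧ ∃ a b : ℝ, ¬ (a = 0 ∧ b = 0) ∧ ∀ j, a * M 0 j + b * M 1 j = 0 := by
  constructor
  · intro h
    refine ⟨fun h0 => by simp [h0] at h, ?_⟩
    by_contra hcon
    have hli : LinearIndependent ℝ M.row := by
      have hrow : M.row = ![M 0, M 1] := by ext i; fin_cases i <;> rfl
      rw [hrow, LinearIndependent.pair_iff]
      intro s t hst
      by_contra hne
      exact hcon ⟨s, t, hne, fun j => by simpa using congrFun hst j⟩
    have := hli.rank_matrix
    simp [h] at this
  · rintro ⟨h0, a, b, hab, hrel⟩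
    obtain ⟨i, j, hij⟩ : ∃ i j, M i j ≠ 0 := by
      by_contra! hcon
      exact h0 (by ext i j; simpa using hcon i j)
    refine le_antisymm ?_ ?_
    -- Every column is orthogonal to `(a, b)`, hence equals its projection onto `(b, -a)`.
    · have hfac : M = Matrix.vecMulVec ![b, -a]
          (fun j => (b * M 0 j - a * M 1 j) / (a ^ 2 + b ^ 2)) := by
        have hpos : a ^ 2 + b ^ 2 ≠ 0 := by
          intro h
          exact hab ⟨by nlinarith [sq_nonneg a, sq_nonneg b],
            by nlinarith [sq_nonneg a, sq_nonneg b]⟩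
        ext i j
        have := hrel j
        fin_cases i
        · simp [Matrix.vecMulVec_apply]
          field_simp
          linear_combination a * this
        · simp [Matrix.vecMulVec_apply]
          field_simp
          linear_combination b * this
      rw [hfac]
      exact Matrix.rank_vecMulVec_le _ _
    · rw [Nat.one_le_iff_ne_zero]
      intro hr
      rw [Matrix.rank, Submodule.finrank_eq_zero, LinearMap.range_eq_bot] at hr
      have := congrFun (congrArg (fun f => f (Pi.single j 1)) hr) i
      simp at this
      exact hij this

/-! ### Rotation-invariant potentials. -/

theorem mul_potential_fst (n : ℕ) (u : ℕ → ℝ) (q : Config) :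
    (n + 1) * (q 0 * potential n u q) = potential (n + 1) (fun h => h * u (h - 1)) q := by
  rw [potential, potential, Finset.sum_range_succ' _ (n + 1), Finset.mul_sum, Finset.mul_sum]
  simp only [Nat.cast_zero, zero_mul, add_zero]
  refine Finset.sum_congr rfl fun h hh => ?_
  have := congrArg (Nat.cast (R := ℝ)) (Nat.add_one_mul_choose_eq n h)
  push_cast at this
  have e : n + 1 - (h + 1) = n - h := by omega
  rw [e]
  simp only [Nat.add_sub_cancel]
  push_cast
  linear_combination (u h * q 0 ^ (h + 1) * q 1 ^ (n - h)) * this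

/-- The weight vanishes at `h = n + 1`, so the coefficient of `u` beyond its range does not matter.
-/
theorem mul_potential_snd (n : ℕ) (u : ℕ → ℝ) (q : Config) :
    (n + 1) * (q 1 * potential n u q) =
      potential (n + 1) (fun h => ((n : ℝ) + 1 - h) * u h) q := by
  rw [potential, potential, Finset.sum_range_succ _ (n + 1), Finset.mul_sum, Finset.mul_sum]
  have : ((n : ℝ) + 1 - (n + 1 : ℕ)) = 0 := by push_cast; ring
  simp only [this, zero_mul, add_zero]
  refine Finset.sum_congr rfl fun h hh => ?_
  obtain ⟨k, rfl⟩ : ∃ k, n = h + k := ⟨n - h, by grind⟩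
  have := congrArg (Nat.cast (R := ℝ)) (Nat.choose_mul_succ_eq (h + k) h)
  have e : h + k + 1 - h = k + 1 := by omega
  have e' : h + k - h = k := by omega
  rw [e] at this ⊢
  rw [e']
  push_cast at this ⊢
  linear_combination (u h * q 0 ^ h * q 1 ^ (k + 1)) * this

/-- Comparing coefficients gives a two-step recursion. At `h = 0` the truncated `h - 1` is harmless,
its factor being 0. -/
theorem rotational_eq_zero_iff (n : ℕ) (v : ℕ → ℝ) :
    (∀ q, rotational n v q = 0) ↔
      ∀ h ≤ n + 2, ((n : ℝ) + 2 - h) * v (h + 1) = h * v (h - 1) := by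
  have key : ∀ q, (n + 2) * rotational n v q = potential (n + 2)
      (fun h => ((n : ℝ) + 2 - h) * v (h + 1) + (-1) * (h * v (h - 1))) q := fun q => by
    have h1 := mul_potential_snd (n + 1) (shift v) q
    have h2 := mul_potential_fst (n + 1) v q
    rw [potential_add, potential_const_mul, ← h2]
    have h3 : (fun h : ℕ => ((n : ℝ) + 2 - h) * v (h + 1)) =
        fun h : ℕ => (((n + 1 : ℕ) : ℝ) + 1 - h) * shift v h := by
      funext h; simp only [shift]; push_cast; ring
    rw [h3, ← h1, rotational]
    push_cast; ring
  have hn : (n : ℝ) + 2 ≠ 0 := by positivity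
  rw [← forall_congr' fun q => (show (n + 2) * rotational n v q = 0 ↔ _ by simp [hn])]
  simp only [key, potential_eq_zero_iff]
  refine forall₂_congr fun h _ => ?_
  constructor <;> intro H <;> linarith

theorem odd_terms_of_rotational {n : ℕ} {v : ℕ → ℝ}
    (H : ∀ h ≤ n + 2, ((n : ℝ) + 2 - h) * v (h + 1) = h * v (h - 1)) (k : ℕ)
    (hk : 2 * k + 1 ≤ n + 2) : v (2 * k + 1) = 0 := by
  induction k with
  | zero =>
    have := H 0 (by omega)
    have hn : (n : ℝ) + 2 ≠ 0 := by positivity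
    simpa [hn] using this
  | succ k ih =>
    have := H (2 * k + 2) (by omega)
    have e : 2 * k + 2 - 1 = 2 * k + 1 := by omega
    rw [e, ih (by omega), mul_zero] at this
    refine (mul_eq_zero.1 this).resolve_left ?_
    have : ((2 * k + 3 : ℕ) : ℝ) ≤ ((n + 2 : ℕ) : ℝ) := by exact_mod_cast hk
    push_cast at this ⊢
    intro h; linarith

theorem even_terms_of_rotational {n : ℕ} {v : ℕ → ℝ}
    (H : ∀ h ≤ n + 2, ((n : ℝ) + 2 - h) * v (h + 1) = h * v (h - 1)) (h0 : v 0 = 0) (k : ℕ)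
    (hk : 2 * k ≤ n + 2) : v (2 * k) = 0 := by
  induction k with
  | zero => simpa using h0
  | succ k ih =>
    have := H (2 * k + 1) (by omega)
    have e : 2 * k + 1 - 1 = 2 * k := by omega
    rw [e, ih (by omega), mul_zero] at this
    refine (mul_eq_zero.1 this).resolve_left ?_
    have : ((2 * k + 2 : ℕ) : ℝ) ≤ ((n + 2 : ℕ) : ℝ) := by exact_mod_cast hk
    push_cast at this ⊢
    intro h; linarith

/-- For odd degree the last relation, `h = n + 2`, kills the even-indexed `v (n + 1)`, and the
recursion then descends to `v 0`. -/
theorem zero_term_of_rotational_of_odd {n : ℕ} (hn : Odd n) {v : ℕ → ℝ}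
    (H : ∀ h ≤ n + 2, ((n : ℝ) + 2 - h) * v (h + 1) = h * v (h - 1)) : v 0 = 0 := by
  obtain ⟨m, rfl⟩ := hn
  have hdown : ∀ k ≤ m + 1, v (2 * (m + 1 - k)) = 0 := by
    intro k
    induction k with
    | zero =>
      intro _
      have := H (2 * m + 1 + 2) le_rfl
      have h0 : (((2 * m + 1 : ℕ) : ℝ) + 2 - (2 * m + 1 + 2 : ℕ)) = 0 := by push_cast; ring
      rw [h0, zero_mul] at this
      refine (mul_eq_zero.1 this.symm).resolve_left ?_
      positivity
    | succ k ih =>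
      intro hk
      have e1 : 2 * (m + 1 - (k + 1)) + 2 = 2 * (m + 1 - k) := by omega
      have := H (2 * (m + 1 - (k + 1)) + 1) (by omega)
      rw [show 2 * (m + 1 - (k + 1)) + 1 + 1 = 2 * (m + 1 - k) by omega, ih (by omega), mul_zero,
        show 2 * (m + 1 - (k + 1)) + 1 - 1 = 2 * (m + 1 - (k + 1)) by omega] at this
      refine (mul_eq_zero.1 this.symm).resolve_left ?_
      positivity
  simpa using hdown (m + 1) le_rfl

theorem vanish_of_rotational {n : ℕ} {v : ℕ → ℝ}
    (H : ∀ h ≤ n + 2, ((n : ℝ) + 2 - h) * v (h + 1) = h * v (h - 1)) (h0 : v 0 = 0) :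
    ∀ h ≤ n + 2, v h = 0 := by
  intro h hh
  rcases Nat.even_or_odd' h with ⟨k, rfl | rfl⟩
  · exact even_terms_of_rotational H h0 k hh
  · exact odd_terms_of_rotational H k hh

/-- These ratios are the normalised coefficients of `(q₁² + q₂²)^m`; they obey the recursion for the
even terms. -/
theorem choose_ratio_succ {m k : ℕ} (hk : k < m) :
    (2 * (m : ℝ) - 1 - 2 * k) *
      ((m.choose (k + 1) : ℝ) / ((2 * m).choose (2 * (k + 1)) : ℝ)) =
    (2 * k + 1) * ((m.choose k : ℝ) / ((2 * m).choose (2 * k) : ℝ)) := by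
  have hb : ((2 * m).choose (2 * k) : ℝ) ≠ 0 := by
    exact_mod_cast (Nat.choose_pos (by omega)).ne'
  have hb2 : ((2 * m).choose (2 * (k + 1)) : ℝ) ≠ 0 := by
    exact_mod_cast (Nat.choose_pos (by omega)).ne'
  have h1 := congrArg (Nat.cast (R := ℝ)) (Nat.choose_succ_right_eq m k)
  have h2 := congrArg (Nat.cast (R := ℝ)) (Nat.choose_succ_right_eq (2 * m) (2 * k))
  have h3 := congrArg (Nat.cast (R := ℝ)) (Nat.choose_succ_right_eq (2 * m) (2 * k + 1))
  rw [show 2 * k + 1 + 1 = 2 * (k + 1) by ring] at h3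
  push_cast [Nat.cast_sub hk.le, Nat.cast_sub (show 2 * k ≤ 2 * m by omega),
    Nat.cast_sub (show 2 * k + 1 ≤ 2 * m by omega)] at h1 h2 h3
  have hk1 : (2 * (k : ℝ) + 2) ≠ 0 := by positivity
  rw [← mul_div_assoc, ← mul_div_assoc, div_eq_div_iff hb2 hb]
  refine mul_left_cancel₀ hk1 ?_
  linear_combination (2 * (2 * (m : ℝ) - 1 - 2 * k) * ((2 * m).choose (2 * k) : ℝ)) * h1 -
    (m.choose k * (2 * k + 1) : ℝ) * h3 - (m.choose k * (2 * m - 2 * k - 1) : ℝ) * h2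

theorem polarRelations_iff {n : ℕ} (hn : Even n) (v : ℕ → ℝ) :
    PolarRelations (n + 2) v ↔ v 0 ≠ 0 ∧ ∀ q, rotational n v q = 0 := by
  obtain ⟨m, rfl⟩ : ∃ m, n = 2 * m := hn.exists_two_nsmul _ |>.imp fun _ h => by simpa using h
  rw [rotational_eq_zero_iff, PolarRelations]
  have hm : (2 * m + 2) / 2 = m + 1 := by omega
  simp only [hm, Finset.mem_Icc]
  refine and_congr_right fun h0 => ⟨?_, fun H => ⟨?_, ?_⟩⟩
  · rintro ⟨hev, hod⟩
    have hev' : ∀ k ≤ m + 1, v (2 * k) =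
        (((m + 1).choose k : ℝ) / ((2 * (m + 1)).choose (2 * k) : ℝ)) * v 0 := by
      intro k hk
      rcases Nat.eq_zero_or_pos k with rfl | hk0
      · simp
      · exact hev k ⟨hk0, hk⟩
    have hod' : ∀ k ≤ m, v (2 * k + 1) = 0 := fun k hk =>
      hod (k + 1) ⟨by omega, by omega⟩
    intro h hh
    rcases Nat.even_or_odd' h with ⟨k, rfl | rfl⟩
    · have e1 : ((2 * m : ℕ) + 2 - (2 * k : ℕ) : ℝ) * v (2 * k + 1) = 0 := by
        rcases (show k ≤ m ∨ k = m + 1 by omega) with hk | rfl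
        · rw [hod' k hk, mul_zero]
        · push_cast; ring
      rw [e1]
      rcases Nat.eq_zero_or_pos k with rfl | hk0
      · simp
      · rw [show 2 * k - 1 = 2 * (k - 1) + 1 by omega, hod' (k - 1) (by omega), mul_zero]
    · have hk : k < m + 1 := by omega
      have := choose_ratio_succ hk
      rw [show 2 * k + 1 + 1 = 2 * (k + 1) by ring, Nat.add_sub_cancel, hev' k hk.le,
        hev' (k + 1) hk]
      push_cast at this ⊢
      linear_combination v 0 * this
  · have hev' : ∀ k ≤ m + 1, v (2 * k) =
        (((m + 1).choose k : ℝ) / ((2 * (m + 1)).choose (2 * k) : ℝ)) * v 0 := by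
      intro k
      induction k with
      | zero => simp
      | succ k ih =>
        intro hk
        have h1 := H (2 * k + 1) (by omega)
        rw [show 2 * k + 1 + 1 = 2 * (k + 1) by ring, Nat.add_sub_cancel, ih (by omega)] at h1
        have h2 := choose_ratio_succ (show k < m + 1 by omega)
        have hne : (2 * ((m + 1 : ℕ) : ℝ) - 1 - 2 * k) ≠ 0 := by
          have : ((k + 1 : ℕ) : ℝ) ≤ ((m + 1 : ℕ) : ℝ) := by exact_mod_cast hk
          push_cast at this ⊢
          intro h; linarith
        refine mul_left_cancel₀ hne ?_
        push_cast at h1 h2 ⊢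
        linear_combination h1 - v 0 * h2
    exact fun k hk => hev' k hk.2
  · intro k hk
    rw [show 2 * k - 1 = 2 * (k - 1) + 1 by omega]
    exact odd_terms_of_rotational H (k - 1) (by omega)

/-! ### The matrix `matM` and potentials of degree at least four. -/

theorem bdConst_eq_zero_iff (n : ℕ) (v : ℕ → ℝ) (μ η : ℝ) :
    (∀ q, bdConst n v μ η q = 0) ↔
      ∀ j, η * matM (n + 2) v 0 j + μ * matM (n + 2) v 1 j = 0 := by
  have key : ∀ q, bdConst n v μ η q = (n + 2) * (n + 1) *
      potential n (fun h => η * (v h + (-1) * v (h + 2)) + μ * (2 * v (h + 1))) q := fun q => by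
    simp only [potential_add, potential_const_mul, bdConst]
    have h1 : potential n (fun h => v (h + 1)) q = potential n (shift v) q := rfl
    have h2 : potential n (fun h => v (h + 2)) q = potential n (shift (shift v)) q := rfl
    rw [h1, h2]
    ring
  have hc : ((n : ℝ) + 2) * (n + 1) ≠ 0 := by positivity
  simp only [key, mul_eq_zero, hc, false_or, potential_eq_zero_iff]
  constructor
  · intro H j
    have := H j (by have := j.2; omega)
    simp [matM]
    linarith
  · intro H h hh
    have := H ⟨h, by omega⟩
    simp [matM] at this
    linarith

/-- The second row controls all inner coefficients; the first ties `v_0` and `v_δ` to inner ones,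
for which `n ≥ 1` is needed. -/
theorem matM_ne_zero {n : ℕ} (hn : 1 ≤ n) {v : ℕ → ℝ} (hv : ∃ h ≤ n + 2, v h ≠ 0) :
    matM (n + 2) v ≠ 0 := by
  intro h0
  have h1 : ∀ h ≤ n, v (h + 1) = 0 := fun h hh => by
    have := congrFun (congrFun h0 1) ⟨h, by omega⟩
    simpa [matM] using this
  have h2 : ∀ h ≤ n, v h = v (h + 2) := fun h hh => by
    have := congrFun (congrFun h0 0) ⟨h, by omega⟩
    simpa [matM, sub_eq_zero] using this
  obtain ⟨h, hh, hne⟩ := hv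
  refine hne ?_
  rcases Nat.eq_zero_or_pos h with rfl | hp
  · rw [h2 0 (by omega)]
    exact h1 1 hn
  · obtain ⟨k, rfl⟩ := Nat.exists_eq_succ_of_ne_zero hp.ne'
    rcases (show k ≤ n ∨ k = n + 1 by omega) with hk | rfl
    · exact h1 k hk
    · obtain ⟨l, rfl⟩ := Nat.exists_eq_succ_of_ne_zero (by omega : n ≠ 0)
      change v (l + 1 + 2) = 0
      rw [← h2 (l + 1) le_rfl]
      exact h1 l (by omega)

theorem rank_matM_eq_one_iff {n : ℕ} (hn : 1 ≤ n) {v : ℕ → ℝ} (hv : ∃ h ≤ n + 2, v h ≠ 0) :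
    (matM (n + 2) v).rank = 1 ↔
      ∃ μ η : ℝ, ¬ (μ = 0 ∧ η = 0) ∧ ∀ q, bdConst n v μ η q = 0 := by
  rw [rank_eq_one_iff, and_iff_right (matM_ne_zero hn hv)]
  constructor
  · rintro ⟨a, b, hab, h⟩
    exact ⟨b, a, fun h' => hab h'.symm, (bdConst_eq_zero_iff n v b a).2 h⟩
  · rintro ⟨μ, η, hab, h⟩
    exact ⟨η, μ, fun h' => hab h'.symm, (bdConst_eq_zero_iff n v μ η).1 h⟩

theorem admits_of_rank_matM {n : ℕ} (hn : 1 ≤ n) {v : ℕ → ℝ} (hv : ∃ h ≤ n + 2, v h ≠ 0)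
    (h : (matM (n + 2) v).rank = 1) : AdmitsQuadraticFirstIntegral (hamiltonian (n + 2) v) := by
  obtain ⟨μ, η, hne, h⟩ := (rank_matM_eq_one_iff hn hv).1 h
  refine admits_of_bertrandDarboux n v 0 0 0 μ η (by tauto) fun q => ?_
  simp [bertrandDarboux, bdLinear, h q]

theorem admits_iff_of_two_le {n : ℕ} (hn : 2 ≤ n) {v : ℕ → ℝ} (hv : ∃ h ≤ n + 2, v h ≠ 0) :
    AdmitsQuadraticFirstIntegral (hamiltonian (n + 2) v) ↔
      (matM (n + 2) v).rank = 1 ∨ ∀ q, rotational n v q = 0 := by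
  constructor
  · intro h
    obtain ⟨α, β, β', μ, η, hne, hBD⟩ := (admits_iff_bertrandDarboux (by omega) v).1 h
    have hs := fun q => bertrandDarboux_split (by omega) hBD q
    by_cases hα : α = 0
    · left
      have hβ : β = 0 := by simpa using ((hs ![1, 0]).2.2.2 hn).1
      have hβ' : β' = 0 := by simpa using ((hs ![0, 1]).2.2.2 hn).1
      exact (rank_matM_eq_one_iff (by omega) hv).2 ⟨μ, η, by tauto,
        fun q => ((hs q).2.2.2 hn).2⟩
    · exact Or.inr fun q => (mul_eq_zero.1 (hs q).2.1).resolve_left hα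
  · rintro (h | h)
    · exact admits_of_rank_matM (by omega) hv h
    · refine admits_of_bertrandDarboux n v 1 0 0 0 0 (by simp) fun q => ?_
      simp [bertrandDarboux, bdLinear, bdConst, h q]

/-! ### Cubic potentials. -/

theorem bdLinear_eq_zero_iff (v : ℕ → ℝ) (β β' : ℝ) :
    (∀ q, bdLinear 1 v β β' q = 0) ↔ ∀ j, β * matN v 0 j + β' * matN v 1 j = 0 := by
  have key : ∀ q, bdLinear 1 v β β' q =
      3 * (q 1 ^ 2 * (β * matN v 0 0 + β' * matN v 1 0)
        + 2 * (q 0 * q 1) * (β * matN v 0 1 + β' * matN v 1 1)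
        + q 0 ^ 2 * (β * matN v 0 2 + β' * matN v 1 2)) := fun q => by
    simp [bdLinear, potential, shift, Finset.sum_range_succ, matN]
    ring
  constructor
  · intro H
    have h1 := H ![1, 0]
    have h2 := H ![0, 1]
    have h3 := H ![1, 1]
    rw [key] at h1 h2 h3
    simp only [Matrix.cons_val_zero, Matrix.cons_val_one] at h1 h2 h3
    rw [Fin.forall_fin_succ, Fin.forall_fin_two]
    refine ⟨?_, ?_, ?_⟩
    · linarith
    · change β * matN v 0 1 + β' * matN v 1 1 = 0
      linarith
    · change β * matN v 0 2 + β' * matN v 1 2 = 0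
      linarith
  · intro H q
    rw [key, H 0, H 1, H 2]
    ring

theorem matN_ne_zero {v : ℕ → ℝ} (hv : ∃ h ≤ 3, v h ≠ 0) : matN v ≠ 0 := by
  intro h0
  have e : ∀ i j, matN v i j = 0 := fun i j => by rw [h0]; rfl
  have h00 := e 0 0
  have h12 := e 1 2
  have h01 := e 0 1
  have h02 := e 0 2
  simp [matN] at h00 h12 h01 h02
  obtain ⟨h, hh, hne⟩ := hv
  interval_cases h <;> apply hne <;> linarith

theorem admits_of_rank_matN {v : ℕ → ℝ} (hv : ∃ h ≤ 3, v h ≠ 0) (h : (matN v).rank = 1) :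
    AdmitsQuadraticFirstIntegral (hamiltonian 3 v) := by
  by_cases hM : (matM 3 v).rank = 1
  · exact admits_of_rank_matM (n := 1) le_rfl hv hM
  obtain ⟨-, β, β', hne, hrel⟩ := (rank_eq_one_iff _).1 h
  have hlin := (bdLinear_eq_zero_iff v β β').2 hrel
  have hM' : ∀ a b : ℝ, (∀ j, a * matM 3 v 0 j + b * matM 3 v 1 j = 0) → a = 0 ∧ b = 0 := by
    intro a b hab
    by_contra hcon
    exact hM ((rank_eq_one_iff _).2 ⟨matM_ne_zero (n := 1) le_rfl hv, a, b, hcon, hab⟩)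
  -- This is half of `det (matM 3 v)`. If it vanished, the rows of the adjugate would be relations
  -- between the rows of `matM`, hence zero, and then `matM` itself would be zero.
  have hdet : (v 0 - v 2) * v 2 - (v 1 - v 3) * v 1 ≠ 0 := by
    intro hdet
    have h1 := hM' (2 * v 2) (-(v 1 - v 3)) (by
      rw [Fin.forall_fin_two]; simp [matM]; constructor <;> linarith)
    have h2 := hM' (2 * v 1) (-(v 0 - v 2)) (by
      rw [Fin.forall_fin_two]; simp [matM]; constructor <;> linarith)
    have h3 := hM' 1 0 (by
      rw [Fin.forall_fin_two]; simp [matM]; constructor <;> linarith)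
    exact one_ne_zero h3.1
  set d := (v 0 - v 2) * v 2 - (v 1 - v 3) * v 1 with hd
  -- μ and η come from Cramer's rule for the degree-one part, a 2 × 2 linear system with determinant
  -- `2 * d`.
  refine admits_of_bertrandDarboux 1 v 0 β β'
    (-((v 0 - v 2) * β + (v 1 - v 3) * β') / (4 * d)) ((v 2 * β' + v 1 * β) / (2 * d))
    (by tauto) fun q => ?_
  rw [bertrandDarboux, hlin q]
  simp [bdConst, potential, shift, Finset.sum_range_succ]
  field_simp
  rw [hd]
  ring

theorem admits_three_iff {v : ℕ → ℝ} (hv : ∃ h ≤ 3, v h ≠ 0) :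
    AdmitsQuadraticFirstIntegral (hamiltonian 3 v) ↔
      (matM 3 v).rank = 1 ∨ (matN v).rank = 1 := by
  refine ⟨fun h => ?_, fun h => h.elim (admits_of_rank_matM (n := 1) le_rfl hv)
    (admits_of_rank_matN hv)⟩
  obtain ⟨α, β, β', μ, η, hne, hBD⟩ := (admits_iff_bertrandDarboux (n := 1) le_rfl v).1 h
  have hs := fun q => bertrandDarboux_split le_rfl hBD q
  have hα : α = 0 := by
    by_contra hα
    have hrot := (rotational_eq_zero_iff 1 v).1 fun q =>
      (mul_eq_zero.1 (hs q).2.1).resolve_left hα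
    obtain ⟨h, hh, hne⟩ := hv
    exact hne (vanish_of_rotational hrot (zero_term_of_rotational_of_odd odd_one hrot) h hh)
  by_cases hβ : β = 0 ∧ β' = 0
  · left
    refine (rank_matM_eq_one_iff (n := 1) le_rfl hv).2 ⟨μ, η, by tauto, fun q => ?_⟩
    simpa [hβ.1, hβ.2] using (hs q).2.2.1 rfl
  · right
    exact (rank_eq_one_iff _).2 ⟨matN_ne_zero hv, β, β', hβ,
      (bdLinear_eq_zero_iff v β β').1 fun q => (hs q).1⟩

end PHO

end

theorem mainTheorem3 (δ : ℕ) (v : ℕ → ℝ) (hv : ∃ h ≤ δ, v h ≠ 0) :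
    (Odd δ → 5 ≤ δ →
      (PHO.AdmitsQuadraticFirstIntegral (PHO.hamiltonian δ v) ↔ (PHO.matM δ v).rank = 1)) ∧
    (Even δ → 4 ≤ δ →
      (PHO.AdmitsQuadraticFirstIntegral (PHO.hamiltonian δ v) ↔
        ((PHO.matM δ v).rank = 1 ∨ PHO.PolarRelations δ v))) ∧
    (δ = 3 →
      (PHO.AdmitsQuadraticFirstIntegral (PHO.hamiltonian δ v) ↔
        ((PHO.matM 3 v).rank = 1 ∨ (PHO.matN v).rank = 1))) := by
  refine ⟨fun hodd hδ => ?_, fun heven hδ => ?_, ?_⟩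
  · obtain ⟨n, rfl⟩ : ∃ n, δ = n + 2 := ⟨δ - 2, by omega⟩
    rw [PHO.admits_iff_of_two_le (by omega) hv]
    -- A rotation-invariant form of odd degree is zero, contrary to `hv`.
    refine or_iff_left fun h => ?_
    have hrot := (PHO.rotational_eq_zero_iff n v).1 h
    obtain ⟨h, hh, hne⟩ := hv
    exact hne (PHO.vanish_of_rotational hrot
      (PHO.zero_term_of_rotational_of_odd (by grind) hrot) h hh)
  · obtain ⟨n, rfl⟩ : ∃ n, δ = n + 2 := ⟨δ - 2, by omega⟩
    rw [PHO.admits_iff_of_two_le (by omega) hv, PHO.polarRelations_iff (by grind)]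
    refine or_congr Iff.rfl ⟨fun h => ⟨fun h0 => ?_, h⟩, And.right⟩
    obtain ⟨k, hk, hne⟩ := hv
    exact hne (PHO.vanish_of_rotational ((PHO.rotational_eq_zero_iff n v).1 h) h0 k hk)
  · rintro rfl
    exact PHO.admits_three_iff hv
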